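/- Let $r\ge 1$ and $n\ge 0$ be integers and let $\Sigma\in\mathbb{R}^{r\times r}$ be symmetric positive definite. Let $S\sim\mathcal{W}_r(n,\Sigma)$ be a Wishart matrix with $n$ degrees of freedom and scale matrix $\Sigma$; that is, $S$ is a random $r\times r$ matrix with the same distribution as $XX^T$, where $X$ is an $r\times n$ random matrix whose columns are independent and distributed according to the multivariate normal distribution $\mathcal{N}_r(0,\Sigma)$. For index sets $A,B\subseteq\{1,\dots,r\}$ of equal size, let $M_{A\times B}$ denote the submatrix of a matrix $M$ with rows in $A$ and columns in $B$, both listed in increasing order. Let $I,J\subseteq\{1,\dots,r\}$ be disjoint with $|I|=|J|=2$ and write $IJ=I\cup J$. Then the tetrad $\det(S_{I\times J})$ is square-integrable, and $$\operatorname{Var}[\det(S_{I\times J})]=n(n-1)\Big[(n+2)\det(\Sigma_{I\times I})\det(\Sigma_{J\times J})-n\det(\Sigma_{IJ\times IJ})+3n\det(\Sigma_{I\times J})^2\Big].$$ -/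

import Mathlib

open MeasureTheory ProbabilityTheory

/-- The product sigma-algebra of the entries (the Borel sigma-algebra) on real `p × q` matrices. -/
instance matrixMeasurableSpace (p q : ℕ) : MeasurableSpace (Matrix (Fin p) (Fin q) ℝ) :=
  inferInstanceAs (MeasurableSpace (Fin p → Fin q → ℝ))

/-- The `r × n` data matrix `X` whose `k`-th column is the vector `x k`. -/
def dataMatrix {r n : ℕ} (x : Fin n → EuclideanSpace ℝ (Fin r)) : Matrix (Fin r) (Fin n) ℝ :=
  Matrix.of fun i k => x k i

/-- The map `x ↦ X Xᵀ` is measurable, so that the push-forward below is a genuine one. -/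
theorem measurable_dataMatrix_mul_transpose (r n : ℕ) :
    Measurable fun x : Fin n → EuclideanSpace ℝ (Fin r) =>
      dataMatrix x * (dataMatrix x).transpose := by
  refine measurable_pi_lambda _ fun i => measurable_pi_lambda _ fun j => ?_
  simp only [Matrix.mul_apply, Matrix.transpose_apply, dataMatrix, Matrix.of_apply]
  fun_prop

/-- The Wishart distribution with `n` degrees of freedom and scale matrix `Sigma`: the law of
`X Xᵀ`, where `X` is an `r × n` random matrix whose columns are independent with the normal
distribution of mean `0` and covariance matrix `Sigma`. -/
noncomputable def wishart (r n : ℕ) (Sigma : Matrix (Fin r) (Fin r) ℝ) :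
    Measure (Matrix (Fin r) (Fin r) ℝ) :=
  (Measure.pi fun _ : Fin n => multivariateGaussian (0 : EuclideanSpace ℝ (Fin r)) Sigma).map
    fun x => dataMatrix x * (dataMatrix x).transpose

/-- The `m × m` minor of `A` with row set `I` and column set `J`, rows and columns being listed in
increasing order. -/
noncomputable def minor {r m : ℕ} (A : Matrix (Fin r) (Fin r) ℝ) (I J : Finset (Fin r))
    (hI : I.card = m) (hJ : J.card = m) : ℝ :=
  (A.submatrix (I.orderEmbOfFin hI) (J.orderEmbOfFin hJ)).det

/-- The union of two disjoint index sets of size `m` has size `2 * m`. -/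
theorem card_union_of_disjoint_of_card_eq {r m : ℕ} {I J : Finset (Fin r)} (hI : I.card = m)
    (hJ : J.card = m) (hIJ : Disjoint I J) : (I ∪ J).card = 2 * m := by
  rw [Finset.card_union_of_disjoint hIJ, hI, hJ, two_mul]

/-! Write I = {a, b}, J = {c, d}, and let x_1, …, x_n be the columns of X. In det(S_{I×J}) = S_ac
S_bd - S_ad S_bc the terms using one column twice cancel, which leaves a difference of two sums over
ordered pairs of distinct columns (`tetrad_eq_sub_distinctPairSum`). Independence gives this
difference the mean n(n-1) det(Σ_{I×J}).

For the second moment, two such sums are multiplied and the terms sorted by how many columns the two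
pairs share: two, one or none. Each term factors into moments of a single column, and the counts are
falling factorials of n (`integral_distinctPairSum_mul_distinctPairSum`). The moments involved have
degree two or four, and Isserlis' theorem (`ProbabilityTheory.IsGaussian.integral_prod_four`)
expresses those of degree four in the entries of Σ. What remains is a polynomial identity in n and
these entries. -/

open scoped ENNReal

/-! ### Functions with finite moments of all orders -/

/-- A real function with finite moments of all orders. -/
def HasFiniteMoments {α : Type*} [MeasurableSpace α] (f : α → ℝ) (μ : Measure α) : Prop :=
  ∀ p : ℝ≥0∞, p ≠ ∞ → MemLp f p μ

namespace HasFiniteMoments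

variable {α β ι : Type*} [MeasurableSpace α] [MeasurableSpace β] {μ : Measure α} {ν : Measure β}
  {f g : α → ℝ}

theorem const [IsFiniteMeasure μ] (c : ℝ) : HasFiniteMoments (fun _ : α => c) μ :=
  fun _ _ => memLp_const c

theorem add (hf : HasFiniteMoments f μ) (hg : HasFiniteMoments g μ) :
    HasFiniteMoments (fun x => f x + g x) μ :=
  fun p hp => (hf p hp).add (hg p hp)

theorem sub (hf : HasFiniteMoments f μ) (hg : HasFiniteMoments g μ) :
    HasFiniteMoments (fun x => f x - g x) μ :=
  fun p hp => (hf p hp).sub (hg p hp)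

/-- Hölder's inequality with 1/(2p) + 1/(2p) = 1/p. The exponent doubles, so closure under products
needs moments of every finite order. -/
theorem mul (hf : HasFiniteMoments f μ) (hg : HasFiniteMoments g μ) :
    HasFiniteMoments (fun x => f x * g x) μ := by
  intro p hp
  have h2 : (2 * p) ≠ ∞ := ENNReal.mul_ne_top (by simp) hp
  have : ENNReal.HolderTriple (2 * p) (2 * p) p := ⟨by
    rw [ENNReal.mul_inv (by simp) (by simp), ← add_mul, ENNReal.inv_two_add_inv_two, one_mul]⟩
  exact (hg _ h2).mul' (hf _ h2)

theorem sum {s : Finset ι} {F : ι → α → ℝ} (h : ∀ i ∈ s, HasFiniteMoments (F i) μ) :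
    HasFiniteMoments (fun x => ∑ i ∈ s, F i x) μ :=
  fun p hp => memLp_finsetSum s fun i hi => h i hi p hp

theorem prod [IsFiniteMeasure μ] {s : Finset ι} {F : ι → α → ℝ}
    (h : ∀ i ∈ s, HasFiniteMoments (F i) μ) :
    HasFiniteMoments (fun x => ∏ i ∈ s, F i x) μ := by
  classical
  induction s using Finset.induction_on with
  | empty => simpa using const 1
  | insert a s ha ih =>
    simp only [Finset.prod_insert ha]
    exact (h a (by simp)).mul (ih fun i hi => h i (by simp [hi]))

theorem integrable (hf : HasFiniteMoments f μ) : Integrable f μ :=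
  memLp_one_iff_integrable.1 (hf 1 (by simp))

theorem comp_measurePreserving {f : β → ℝ} (hf : HasFiniteMoments f ν) {φ : α → β}
    (hφ : MeasurePreserving φ μ ν) : HasFiniteMoments (fun x => f (φ x)) μ :=
  fun p hp => (hf p hp).comp_measurePreserving hφ

end HasFiniteMoments

theorem ProbabilityTheory.IsGaussian.hasFiniteMoments_dual {E : Type*} [NormedAddCommGroup E]
    [NormedSpace ℝ E] [MeasurableSpace E] [BorelSpace E] (μ : Measure E) [IsGaussian μ]
    (L : StrongDual ℝ E) : HasFiniteMoments L μ :=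
  fun p hp => IsGaussian.memLp_dual μ L p hp

/-! ### Isserlis' theorem from rotation invariance -/

theorem sum_powerset_univ_fin_four (F : Finset (Fin 4) → Finset (Fin 4) → ℝ) :
    ∑ t ∈ (Finset.univ : Finset (Fin 4)).powerset, F t (Finset.univ \ t) =
      F ∅ {0, 1, 2, 3} + F {0, 1, 2, 3} ∅
        + (F {0, 1} {2, 3} + F {2, 3} {0, 1} + (F {0, 2} {1, 3} + F {1, 3} {0, 2})
          + (F {0, 3} {1, 2} + F {1, 2} {0, 3}))
        + (F {0} {1, 2, 3} + F {1} {0, 2, 3} + F {2} {0, 1, 3} + F {3} {0, 1, 2})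
        + (F {1, 2, 3} {0} + F {0, 2, 3} {1} + F {0, 1, 3} {2} + F {0, 1, 2} {3}) := by
  have h : (Finset.univ : Finset (Fin 4)).powerset.val.map (fun t => (t, Finset.univ \ t)) =
      {(∅, {0, 1, 2, 3}), ({0, 1, 2, 3}, ∅), ({0, 1}, {2, 3}), ({2, 3}, {0, 1}),
        ({0, 2}, {1, 3}), ({1, 3}, {0, 2}), ({0, 3}, {1, 2}), ({1, 2}, {0, 3}),
        ({0}, {1, 2, 3}), ({1}, {0, 2, 3}), ({2}, {0, 1, 3}), ({3}, {0, 1, 2}),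
        ({1, 2, 3}, {0}), ({0, 2, 3}, {1}), ({0, 1, 3}, {2}), ({0, 1, 2}, {3})} := by decide
  have h' := congrArg (fun m => (m.map fun z => F z.1 z.2).sum) h
  simp only [Multiset.map_map, Function.comp_def, Multiset.insert_eq_cons, Multiset.map_cons,
    Multiset.sum_cons, Multiset.map_singleton, Multiset.sum_singleton] at h'
  rw [Finset.sum, h']
  ring

/-- **Isserlis' theorem** for products of four linear forms in a centred Gaussian vector. -/
theorem ProbabilityTheory.IsGaussian.integral_prod_four {E : Type*} [NormedAddCommGroup E]
    [NormedSpace ℝ E] [CompleteSpace E] [SecondCountableTopology E] [MeasurableSpace E]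
    [BorelSpace E] (μ : Measure E) [IsGaussian μ] (hμ : μ[id] = 0) (L : Fin 4 → StrongDual ℝ E) :
    ∫ x, L 0 x * L 1 x * (L 2 x * L 3 x) ∂μ =
      (∫ x, L 0 x * L 1 x ∂μ) * (∫ x, L 2 x * L 3 x ∂μ)
        + (∫ x, L 0 x * L 2 x ∂μ) * (∫ x, L 1 x * L 3 x ∂μ)
        + (∫ x, L 0 x * L 3 x ∂μ) * (∫ x, L 1 x * L 2 x ∂μ) := by
  have hfin (t : Finset (Fin 4)) : HasFiniteMoments (fun x => ∏ i ∈ t, L i x) μ :=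
    HasFiniteMoments.prod fun i _ => IsGaussian.hasFiniteMoments_dual μ (L i)
  have hfst (t : Finset (Fin 4)) : HasFiniteMoments (fun z : E × E => ∏ i ∈ t, L i z.1) (μ.prod μ) :=
    (hfin t).comp_measurePreserving measurePreserving_fst
  have hsnd (t : Finset (Fin 4)) : HasFiniteMoments (fun z : E × E => ∏ i ∈ t, L i z.2) (μ.prod μ) :=
    (hfin t).comp_measurePreserving measurePreserving_snd
  have hmean (i : Fin 4) : ∫ x, L i x ∂μ = 0 := by
    rw [IsGaussian.integral_dual]
    simp only [id] at hμ
    simp [hμ]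
  -- For independent copies z₁, z₂ of the centred Gaussian, (z₁ + z₂)/√2 has the same law as z₁.
  -- Expanding the product of the four forms over subsets then separates the copies.
  have key : ∫ x, ∏ i, L i x ∂μ = (1 / 4) * ∑ t ∈ (Finset.univ : Finset (Fin 4)).powerset,
      (∫ x, ∏ i ∈ t, L i x ∂μ) * ∫ x, ∏ i ∈ Finset.univ \ t, L i x ∂μ := by
    calc ∫ x, ∏ i, L i x ∂μ
        = ∫ z, ∏ i, L i z.1 ∂(μ.prod μ) := by
          have := integral_prod_mul (μ := μ) (ν := μ) (fun x => ∏ i, L i x) fun _ => (1 : ℝ)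
          simpa using this.symm
      _ = ∫ z, ∏ i, L i (ContinuousLinearMap.rotation (Real.pi / 4) z).1 ∂(μ.prod μ) := by
          conv_lhs => rw [← IsGaussian.map_rotation_eq_self hμ (Real.pi / 4)]
          rw [integral_map (by fun_prop) (by fun_prop)]
      _ = ∫ z, (1 / 4) * ∑ t ∈ (Finset.univ : Finset (Fin 4)).powerset,
            (∏ i ∈ t, L i z.1) * ∏ i ∈ Finset.univ \ t, L i z.2 ∂(μ.prod μ) := by
          congr 1 with z
          rw [← Finset.prod_add]
          -- The cosine and sine of π/4 are both √2/2, and each of the four forms contributes one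
          -- such factor.
          have h4 : (√2 / 2) ^ 4 = (1 / 4 : ℝ) := by
            rw [div_pow, show (√2 : ℝ) ^ 4 = (√2 ^ 2) ^ 2 by ring, Real.sq_sqrt (by norm_num)]
            norm_num
          simp only [ContinuousLinearMap.rotation_apply, Real.cos_pi_div_four,
            Real.sin_pi_div_four, map_add, map_smul, smul_eq_mul, ← mul_add,
            Finset.prod_mul_distrib, Finset.prod_const, Finset.card_univ, Fintype.card_fin, h4]
      _ = _ := by
          rw [integral_const_mul, integral_finsetSum _ fun t _ => ((hfst t).mul (hsnd _)).integrable]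
          congr 2 with t
          exact integral_prod_mul (fun x => ∏ i ∈ t, L i x) fun x => ∏ i ∈ Finset.univ \ t, L i x
  rw [sum_powerset_univ_fin_four fun s t => (∫ x, ∏ i ∈ s, L i x ∂μ) * ∫ x, ∏ i ∈ t, L i x ∂μ,
    show (Finset.univ : Finset (Fin 4)) = {0, 1, 2, 3} by decide] at key
  -- A subset of size one or three yields a factor with a single form, whose mean is zero.
  simp only [Finset.prod_singleton, hmean, zero_mul, mul_zero] at key
  simp [← mul_assoc] at key ⊢
  -- The empty and the full subset each reproduce the left-hand side, and each pairing occurs twice: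
  -- half the moment equals half the sum over pairings.
  linarith

/-! ### Sums over distinct pairs of independent samples -/

/-- The sum of `f (x k) * g (x l)` over all ordered pairs of distinct indices `k`, `l`. -/
def distinctPairSum {α : Type*} {n : ℕ} (f g : α → ℝ) (x : Fin n → α) : ℝ :=
  ∑ k, ∑ l, if k = l then 0 else f (x k) * g (x l)

theorem sum_mul_sum_eq_distinctPairSum_add {α : Type*} {n : ℕ} (f g : α → ℝ) (x : Fin n → α) :
    (∑ k, f (x k)) * ∑ l, g (x l) = distinctPairSum f g x + ∑ k, f (x k) * g (x k) := by
  rw [distinctPairSum, ← Finset.sum_add_distrib, Finset.sum_mul_sum]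
  refine Finset.sum_congr rfl fun k _ => ?_
  have : f (x k) * g (x k) = ∑ l, if k = l then f (x k) * g (x l) else 0 := by simp
  rw [this, ← Finset.sum_add_distrib]
  refine Finset.sum_congr rfl fun l _ => ?_
  split_ifs <;> simp

section

variable {α : Type*} [MeasurableSpace α] {ν : Measure α} [IsProbabilityMeasure ν] {n : ℕ}

theorem HasFiniteMoments.eval {f : α → ℝ} (hf : HasFiniteMoments f ν) (k : Fin n) :
    HasFiniteMoments (fun x : Fin n → α => f (x k)) (Measure.pi fun _ => ν) :=
  hf.comp_measurePreserving (measurePreserving_eval (fun _ => ν) k)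

theorem HasFiniteMoments.ite_eval_mul_eval {f g : α → ℝ} (hf : HasFiniteMoments f ν)
    (hg : HasFiniteMoments g ν) (k l : Fin n) :
    HasFiniteMoments (fun x : Fin n → α => if k = l then 0 else f (x k) * g (x l))
      (Measure.pi fun _ => ν) := by
  split_ifs
  · exact .const 0
  · exact (hf.eval k).mul (hg.eval l)

theorem HasFiniteMoments.distinctPairSum {f g : α → ℝ} (hf : HasFiniteMoments f ν)
    (hg : HasFiniteMoments g ν) :
    HasFiniteMoments (distinctPairSum (n := n) f g) (Measure.pi fun _ => ν) :=
  .sum fun k _ => .sum fun l _ => hf.ite_eval_mul_eval hg k l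

/-- Distinct coordinates of a product measure are independent. The cases of two, three and four
coordinates cover all coincidence patterns needed below. -/
theorem integral_pi_prod_eval_of_injective {m : ℕ} {F : Fin m → α → ℝ}
    (hF : ∀ i, HasFiniteMoments (F i) ν) {σ : Fin m → Fin n} (hσ : σ.Injective) :
    ∫ x : Fin n → α, ∏ i, F i (x (σ i)) ∂(Measure.pi fun _ => ν) = ∏ i, ∫ y, F i y ∂ν := by
  have hind : iIndepFun (fun i (x : Fin n → α) => x (σ i)) (Measure.pi fun _ => ν) :=
    (iIndepFun_pi (μ := fun _ : Fin n => ν) (X := fun _ => id)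
      fun _ => aemeasurable_id).precomp hσ
  have hmp (i : Fin m) := measurePreserving_eval (fun _ : Fin n => ν) (σ i)
  have hasm (i : Fin m) : AEStronglyMeasurable (F i) ν := (hF i).integrable.aestronglyMeasurable
  rw [hind.integral_fun_prod_comp (fun i => (measurable_pi_apply (σ i)).aemeasurable) fun i => by
    exact (hmp i).map_eq.symm ▸ hasm i]
  refine Finset.prod_congr rfl fun i _ => ?_
  conv_rhs => rw [← (hmp i).map_eq]
  rw [integral_map (hmp i).aemeasurable ((hmp i).map_eq.symm ▸ hasm i)]

theorem integral_pi_eval_mul_eval {f g : α → ℝ} (hf : HasFiniteMoments f ν)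
    (hg : HasFiniteMoments g ν) {k l : Fin n} (hkl : k ≠ l) :
    ∫ x : Fin n → α, f (x k) * g (x l) ∂(Measure.pi fun _ => ν) =
      (∫ y, f y ∂ν) * ∫ y, g y ∂ν := by
  have := integral_pi_prod_eval_of_injective (ν := ν) (F := ![f, g]) (σ := ![k, l])
    (by intro i; fin_cases i <;> assumption)
    (by intro i j; fin_cases i <;> fin_cases j <;> simp [hkl, hkl.symm])
  simpa [Fin.prod_univ_two] using this

theorem integral_pi_eval_mul_eval_mul_eval {f g h : α → ℝ} (hf : HasFiniteMoments f ν)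
    (hg : HasFiniteMoments g ν) (hh : HasFiniteMoments h ν) {k l m : Fin n} (hkl : k ≠ l)
    (hkm : k ≠ m) (hlm : l ≠ m) :
    ∫ x : Fin n → α, f (x k) * g (x l) * h (x m) ∂(Measure.pi fun _ => ν) =
      (∫ y, f y ∂ν) * (∫ y, g y ∂ν) * ∫ y, h y ∂ν := by
  have := integral_pi_prod_eval_of_injective (ν := ν) (F := ![f, g, h]) (σ := ![k, l, m])
    (by intro i; fin_cases i <;> assumption)
    (by intro i j; fin_cases i <;> fin_cases j <;>
          simp [hkl, hkl.symm, hkm, hkm.symm, hlm, hlm.symm])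
  simpa [Fin.prod_univ_three] using this

theorem integral_pi_four_eval {f g h u : α → ℝ} (hf : HasFiniteMoments f ν)
    (hg : HasFiniteMoments g ν) (hh : HasFiniteMoments h ν) (hu : HasFiniteMoments u ν)
    {k l m p : Fin n} (hkl : k ≠ l) (hkm : k ≠ m) (hkp : k ≠ p) (hlm : l ≠ m) (hlp : l ≠ p)
    (hmp : m ≠ p) :
    ∫ x : Fin n → α, f (x k) * g (x l) * h (x m) * u (x p) ∂(Measure.pi fun _ => ν) =
      (∫ y, f y ∂ν) * (∫ y, g y ∂ν) * (∫ y, h y ∂ν) * ∫ y, u y ∂ν := by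
  have := integral_pi_prod_eval_of_injective (ν := ν) (F := ![f, g, h, u]) (σ := ![k, l, m, p])
    (by intro i; fin_cases i <;> assumption)
    (by intro i j; fin_cases i <;> fin_cases j <;>
          simp [hkl, hkl.symm, hkm, hkm.symm, hlm, hlm.symm, hkp, hkp.symm, hlp, hlp.symm, hmp,
            hmp.symm])
  simpa [Fin.prod_univ_four] using this

theorem sum_sum_ite_eq_zero (n : ℕ) (c : ℝ) :
    ∑ k : Fin n, ∑ l : Fin n, (if k = l then 0 else c) = n * (n - 1) * c := by
  have (k l : Fin n) : (if k = l then 0 else c) = c - if k = l then c else 0 := by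
    split_ifs <;> simp
  simp only [this, Finset.sum_sub_distrib, Finset.sum_ite_eq, Finset.mem_univ, if_true,
    Finset.sum_const, Finset.card_univ, Fintype.card_fin, nsmul_eq_mul]
  ring

theorem integral_distinctPairSum {f g : α → ℝ} (hf : HasFiniteMoments f ν)
    (hg : HasFiniteMoments g ν) :
    ∫ x, distinctPairSum (n := n) f g x ∂(Measure.pi fun _ => ν) =
      n * (n - 1) * ((∫ y, f y ∂ν) * ∫ y, g y ∂ν) := by
  unfold distinctPairSum
  rw [integral_finsetSum _ fun k _ => (HasFiniteMoments.sum fun l _ =>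
    hf.ite_eval_mul_eval hg k l).integrable, ← sum_sum_ite_eq_zero]
  refine Finset.sum_congr rfl fun k _ => ?_
  rw [integral_finsetSum _ fun l _ => (hf.ite_eval_mul_eval hg k l).integrable]
  refine Finset.sum_congr rfl fun l _ => ?_
  split_ifs with hkl
  · simp
  · exact integral_pi_eval_mul_eval hf hg hkl

/-- The mixed second moment of two off-diagonal sums, sorted by the coincidences between the two
pairs of indices. -/
theorem integral_distinctPairSum_mul_distinctPairSum {f g h u : α → ℝ}
    (hf : HasFiniteMoments f ν) (hg : HasFiniteMoments g ν) (hh : HasFiniteMoments h ν)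
    (hu : HasFiniteMoments u ν) :
    ∫ x, distinctPairSum (n := n) f g x * distinctPairSum h u x ∂(Measure.pi fun _ => ν) =
      n * (n - 1) * ((∫ y, f y * h y ∂ν) * (∫ y, g y * u y ∂ν)
          + (∫ y, f y * u y ∂ν) * ∫ y, g y * h y ∂ν)
        + n * (n - 1) * (n - 2) *
          ((∫ y, f y * h y ∂ν) * (∫ y, g y ∂ν) * (∫ y, u y ∂ν)
            + (∫ y, f y * u y ∂ν) * (∫ y, g y ∂ν) * (∫ y, h y ∂ν)
            + (∫ y, g y * h y ∂ν) * (∫ y, f y ∂ν) * (∫ y, u y ∂ν)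
            + (∫ y, g y * u y ∂ν) * (∫ y, f y ∂ν) * (∫ y, h y ∂ν))
        + n * (n - 1) * (n - 2) * (n - 3) *
          ((∫ y, f y ∂ν) * (∫ y, g y ∂ν) * (∫ y, h y ∂ν) * ∫ y, u y ∂ν) := by
  set a := ∫ y, f y ∂ν
  set b := ∫ y, g y ∂ν
  set c := ∫ y, h y ∂ν
  set d := ∫ y, u y ∂ν
  set fh := ∫ y, f y * h y ∂ν
  set fu := ∫ y, f y * u y ∂ν
  set gh := ∫ y, g y * h y ∂ν
  set gu := ∫ y, g y * u y ∂ν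
  let δ : Fin n → Fin n → ℝ := fun i j => if i = j then 1 else 0
  -- One polynomial in the Kronecker deltas covers all coincidence patterns, so that summing over m
  -- and p becomes mechanical. Its coefficients come from inclusion-exclusion: the generic value, a
  -- correction for each single coincidence, then one for each double coincidence. The last two
  -- terms need no factor `1 - δ m p`, since they vanish at m = p because k ≠ l.
  have hterm (k l m p : Fin n) (hkl : k ≠ l) :
      ∫ x : Fin n → α, (f (x k) * g (x l)) * (if m = p then 0 else h (x m) * u (x p))
          ∂(Measure.pi fun _ => ν) =
        a * b * c * d * (1 - δ m p) + (fh * b * d - a * b * c * d) * (δ k m * (1 - δ m p))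
          + (fu * b * c - a * b * c * d) * (δ k p * (1 - δ m p))
          + (gh * a * d - a * b * c * d) * (δ l m * (1 - δ m p))
          + (gu * a * c - a * b * c * d) * (δ l p * (1 - δ m p))
          + (fh * gu - fh * b * d - gu * a * c + a * b * c * d) * (δ k m * δ l p)
          + (fu * gh - fu * b * c - gh * a * d + a * b * c * d) * (δ k p * δ l m) := by
    by_cases hmp : m = p
    · subst hmp
      by_cases hk : k = m
      · subst hk
        simp [δ, hkl.symm]
      · simp [δ, hk]
    by_cases hkm : k = m
    · subst hkm
      by_cases hlp : l = p
      · subst hlp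
        refine ((integral_congr_ae (.of_forall fun x => ?_)).trans
          (integral_pi_eval_mul_eval (hf.mul hh) (hg.mul hu) hkl)).trans ?_
        · simp [hmp]; ring
        · simp [δ, fh, gu, hmp, hkl.symm]; ring
      · refine ((integral_congr_ae (.of_forall fun x => ?_)).trans
          (integral_pi_eval_mul_eval_mul_eval (hf.mul hh) hg hu hkl hmp hlp)).trans ?_
        · simp [hmp]; ring
        · simp [δ, fh, b, d, hmp, hlp, hkl.symm]
    by_cases hkp : k = p
    · subst hkp
      by_cases hlm : l = m
      · subst hlm
        refine ((integral_congr_ae (.of_forall fun x => ?_)).trans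
          (integral_pi_eval_mul_eval (hf.mul hu) (hg.mul hh) hkl)).trans ?_
        · simp [hmp]; ring
        · simp [δ, fu, gh, hmp, hkl]; ring
      · refine ((integral_congr_ae (.of_forall fun x => ?_)).trans
          (integral_pi_eval_mul_eval_mul_eval (hf.mul hu) hg hh hkl hkm hlm)).trans ?_
        · simp [hmp]; ring
        · simp [δ, fu, b, c, hmp, hlm, hkm, hkl.symm]
    by_cases hlm : l = m
    · subst hlm
      refine ((integral_congr_ae (.of_forall fun x => ?_)).trans
        (integral_pi_eval_mul_eval_mul_eval (hg.mul hh) hf hu hkl.symm hmp hkp)).trans ?_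
      · simp [hmp]; ring
      · simp [δ, gh, a, d, hmp, hkp, hkl]
    by_cases hlp : l = p
    · subst hlp
      refine ((integral_congr_ae (.of_forall fun x => ?_)).trans
        (integral_pi_eval_mul_eval_mul_eval (hg.mul hu) hf hh hkl.symm hlm hkm)).trans ?_
      · simp [hmp]; ring
      · simp [δ, gu, a, c, hmp, hkm, hkp, hlm]
    refine ((integral_congr_ae (.of_forall fun x => ?_)).trans
      (integral_pi_four_eval hf hg hh hu hkl hkm hkp hlm hlp hmp)).trans ?_
    · simp [hmp]; ring
    · simp [δ, a, b, c, d, hmp, hkm, hkp, hlm, hlp]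
  have hpair (k l : Fin n) (hkl : k ≠ l) :
      ∫ x : Fin n → α, (f (x k) * g (x l)) * distinctPairSum h u x ∂(Measure.pi fun _ => ν) =
        (fh * gu + fu * gh) + (n - 2) * (fh * b * d + fu * b * c + gh * a * d + gu * a * c)
          + (n - 2) * (n - 3) * (a * b * c * d) := by
    simp only [distinctPairSum, Finset.mul_sum]
    rw [integral_finsetSum _ fun m _ => (HasFiniteMoments.sum fun p _ =>
      ((hf.eval k).mul (hg.eval l)).mul (hh.ite_eval_mul_eval hu m p)).integrable]
    have (m : Fin n) := integral_finsetSum (μ := Measure.pi fun _ : Fin n => ν) Finset.univ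
      fun p _ => (((hf.eval k).mul (hg.eval l)).mul (hh.ite_eval_mul_eval hu m p)).integrable
    simp only [this, hterm k l _ _ hkl]
    simp only [Finset.sum_add_distrib, ← Finset.mul_sum, Finset.sum_sub_distrib, mul_sub, mul_one]
    simp [δ]
    ring
  have hpair' (k l : Fin n) :
      ∫ x : Fin n → α, (if k = l then 0 else f (x k) * g (x l)) * distinctPairSum h u x
          ∂(Measure.pi fun _ => ν) =
        if k = l then 0 else
        (fh * gu + fu * gh) + (n - 2) * (fh * b * d + fu * b * c + gh * a * d + gu * a * c)
          + (n - 2) * (n - 3) * (a * b * c * d) := by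
    split_ifs with hkl
    · simp
    · exact hpair k l hkl
  have hint (k l : Fin n) := (hf.ite_eval_mul_eval hg k l).mul (hh.distinctPairSum (n := n) hu)
  calc _ = ∫ x, ∑ k, ∑ l, (if k = l then 0 else f (x k) * g (x l)) * distinctPairSum h u x
          ∂(Measure.pi fun _ : Fin n => ν) := by
        congr 1 with x
        simp only [← Finset.sum_mul]
        rfl
    _ = ∑ k : Fin n, ∑ l : Fin n, if k = l then 0 else
        (fh * gu + fu * gh) + (n - 2) * (fh * b * d + fu * b * c + gh * a * d + gu * a * c)
          + (n - 2) * (n - 3) * (a * b * c * d) := by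
        rw [integral_finsetSum _ fun k _ => (HasFiniteMoments.sum fun l _ => hint k l).integrable]
        refine Finset.sum_congr rfl fun k _ => ?_
        rw [integral_finsetSum _ fun l _ => (hint k l).integrable]
        exact Finset.sum_congr rfl fun l _ => hpair' k l
    _ = _ := by
        rw [sum_sum_ite_eq_zero]
        ring

end

/-! ### Small determinants and principal minors -/

/-- This is the Laplace expansion into 2 × 2 minors of the first two rows and complementary minors
of the last two. -/
theorem Matrix.det_fin_four {R : Type*} [CommRing R] (A : Matrix (Fin 4) (Fin 4) R) :
    A.det = (A 0 0 * A 1 1 - A 0 1 * A 1 0) * (A 2 2 * A 3 3 - A 2 3 * A 3 2)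
      - (A 0 0 * A 1 2 - A 0 2 * A 1 0) * (A 2 1 * A 3 3 - A 2 3 * A 3 1)
      + (A 0 0 * A 1 3 - A 0 3 * A 1 0) * (A 2 1 * A 3 2 - A 2 2 * A 3 1)
      + (A 0 1 * A 1 2 - A 0 2 * A 1 1) * (A 2 0 * A 3 3 - A 2 3 * A 3 0)
      - (A 0 1 * A 1 3 - A 0 3 * A 1 1) * (A 2 0 * A 3 2 - A 2 2 * A 3 0)
      + (A 0 2 * A 1 3 - A 0 3 * A 1 2) * (A 2 0 * A 3 1 - A 2 1 * A 3 0) := by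
  rw [Matrix.det_succ_row_zero, Fin.sum_univ_four]
  simp only [Matrix.det_fin_three, Matrix.submatrix_apply]
  simp [Fin.succAbove]
  ring

/-- A principal minor may be computed from any enumeration of its index set. -/
theorem minor_self_eq_det_submatrix {r m : ℕ} (A : Matrix (Fin r) (Fin r) ℝ)
    (K : Finset (Fin r)) (hK : K.card = m) {s : Fin m → Fin r} (hs : s.Injective)
    (hsK : ∀ i, s i ∈ K) : minor A K K hK hK = (A.submatrix s s).det := by
  let e₁ : Fin m ≃ K := Equiv.ofBijective (fun i => ⟨s i, hsK i⟩) <| by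
    rw [Fintype.bijective_iff_injective_and_card]
    exact ⟨fun i j h => hs (congrArg Subtype.val h), by simp [hK]⟩
  -- The enumeration `s` differs from the increasing one by a permutation, which acts on rows and
  -- columns alike, so its sign cancels.
  let e : Fin m ≃ Fin m := e₁.trans (K.orderIsoOfFin hK).symm.toEquiv
  have he (i : Fin m) : K.orderEmbOfFin hK (e i) = s i := by
    rw [← Finset.coe_orderIsoOfFin_apply]
    simp [e, e₁]
  have : A.submatrix s s =
      (A.submatrix (K.orderEmbOfFin hK) (K.orderEmbOfFin hK)).submatrix e e := by
    ext i j
    simp [he]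
  rw [this, Matrix.det_submatrix_equiv_self, minor]

theorem dataMatrix_mul_transpose_apply {r n : ℕ} (x : Fin n → EuclideanSpace ℝ (Fin r))
    (i j : Fin r) : (dataMatrix x * (dataMatrix x).transpose) i j = ∑ k, x k i * x k j := by
  simp [Matrix.mul_apply, dataMatrix]

/-! ### Gaussian moments and the variance of the tetrad -/

section

variable {r : ℕ} {Sigma : Matrix (Fin r) (Fin r) ℝ}

theorem hasFiniteMoments_multivariateGaussian_eval (i : Fin r) :
    HasFiniteMoments (fun x : EuclideanSpace ℝ (Fin r) => x i) (multivariateGaussian 0 Sigma) :=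
  IsGaussian.hasFiniteMoments_dual _ (EuclideanSpace.proj i : StrongDual ℝ _)

theorem integral_multivariateGaussian_eval (i : Fin r) :
    ∫ x, x i ∂(multivariateGaussian (0 : EuclideanSpace ℝ (Fin r)) Sigma) = 0 := by
  have := IsGaussian.integral_dual (μ := multivariateGaussian (0 : EuclideanSpace ℝ (Fin r)) Sigma)
    (EuclideanSpace.proj i : StrongDual ℝ _)
  simpa using this

theorem integral_multivariateGaussian_mul (hSigma : Sigma.PosSemidef) (i j : Fin r) :
    ∫ x, x i * x j ∂(multivariateGaussian (0 : EuclideanSpace ℝ (Fin r)) Sigma) = Sigma i j := by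
  rw [← covariance_eval_multivariateGaussian (μ := 0) hSigma i j,
    covariance_eq_sub (hasFiniteMoments_multivariateGaussian_eval i 2 (by simp))
      (hasFiniteMoments_multivariateGaussian_eval j 2 (by simp)),
    integral_multivariateGaussian_eval, zero_mul, sub_zero]
  rfl

theorem integral_multivariateGaussian_mul_four (hSigma : Sigma.PosSemidef) (i j k l : Fin r) :
    ∫ x, x i * x j * (x k * x l) ∂(multivariateGaussian (0 : EuclideanSpace ℝ (Fin r)) Sigma) =
      Sigma i j * Sigma k l + Sigma i k * Sigma j l + Sigma i l * Sigma j k := by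
  have := IsGaussian.integral_prod_four
    (multivariateGaussian (0 : EuclideanSpace ℝ (Fin r)) Sigma) (by simp)
    ![EuclideanSpace.proj i, EuclideanSpace.proj j, EuclideanSpace.proj k, EuclideanSpace.proj l]
  simpa [integral_multivariateGaussian_mul hSigma] using this

/-- The tetrad of a sample covariance matrix is a difference of off-diagonal sums: the diagonal
contributions cancel. -/
theorem tetrad_eq_sub_distinctPairSum {n : ℕ} (x : Fin n → EuclideanSpace ℝ (Fin r))
    (a b c d : Fin r) :
    (∑ k, x k a * x k c) * (∑ k, x k b * x k d) - (∑ k, x k a * x k d) * (∑ k, x k b * x k c) =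
      distinctPairSum (fun y : EuclideanSpace ℝ (Fin r) => y a * y c) (fun y => y b * y d) x
        - distinctPairSum (fun y : EuclideanSpace ℝ (Fin r) => y a * y d)
            (fun y => y b * y c) x := by
  have h₁ := sum_mul_sum_eq_distinctPairSum_add
    (fun y : EuclideanSpace ℝ (Fin r) => y a * y c) (fun y => y b * y d) x
  have h₂ := sum_mul_sum_eq_distinctPairSum_add
    (fun y : EuclideanSpace ℝ (Fin r) => y a * y d) (fun y => y b * y c) x
  have h₃ : ∑ k, x k a * x k c * (x k b * x k d) = ∑ k, x k a * x k d * (x k b * x k c) :=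
    Finset.sum_congr rfl fun k _ => by ring
  linarith

theorem hasFiniteMoments_tetrad (n : ℕ) (a b c d : Fin r) :
    HasFiniteMoments (fun x : Fin n → EuclideanSpace ℝ (Fin r) =>
      (∑ k, x k a * x k c) * (∑ k, x k b * x k d) - (∑ k, x k a * x k d) * (∑ k, x k b * x k c))
      (Measure.pi fun _ => multivariateGaussian 0 Sigma) := by
  have h (i j : Fin r) : HasFiniteMoments (fun y : EuclideanSpace ℝ (Fin r) => y i * y j)
      (multivariateGaussian 0 Sigma) :=
    (hasFiniteMoments_multivariateGaussian_eval i).mul (hasFiniteMoments_multivariateGaussian_eval j)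
  simp only [tetrad_eq_sub_distinctPairSum]
  exact ((h a c).distinctPairSum (h b d)).sub ((h a d).distinctPairSum (h b c))

/-- After the moments are substituted, both sides are polynomials in n and the entries of `Sigma`,
so semidefiniteness suffices and the four indices may coincide. -/
theorem variance_tetrad (hSigma : Sigma.PosSemidef) (n : ℕ) (a b c d : Fin r) :
    variance (fun x : Fin n → EuclideanSpace ℝ (Fin r) =>
      (∑ k, x k a * x k c) * (∑ k, x k b * x k d) - (∑ k, x k a * x k d) * (∑ k, x k b * x k c))
      (Measure.pi fun _ => multivariateGaussian 0 Sigma) =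
      n * (n - 1) * ((n + 2) * (Sigma.submatrix ![a, b] ![a, b]).det
          * (Sigma.submatrix ![c, d] ![c, d]).det
        - n * (Sigma.submatrix ![a, b, c, d] ![a, b, c, d]).det
        + 3 * n * (Sigma.submatrix ![a, b] ![c, d]).det ^ 2) := by
  have h (i j : Fin r) : HasFiniteMoments (fun y : EuclideanSpace ℝ (Fin r) => y i * y j)
      (multivariateGaussian 0 Sigma) :=
    (hasFiniteMoments_multivariateGaussian_eval i).mul (hasFiniteMoments_multivariateGaussian_eval j)
  have hs (i j : Fin r) : Sigma i j = Sigma j i := by simpa using hSigma.isHermitian.apply j i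
  have h₁ := (h a c).distinctPairSum (n := n) (h b d)
  have h₂ := (h a d).distinctPairSum (n := n) (h b c)
  have hsq (x : Fin n → EuclideanSpace ℝ (Fin r)) := sub_sq'
    (distinctPairSum (fun y : EuclideanSpace ℝ (Fin r) => y a * y c) (fun y => y b * y d) x)
    (distinctPairSum (fun y : EuclideanSpace ℝ (Fin r) => y a * y d) (fun y => y b * y c) x)
  rw [variance_eq_sub (hasFiniteMoments_tetrad n a b c d 2 (by simp))]
  simp only [tetrad_eq_sub_distinctPairSum, Pi.pow_apply, hsq, sq (distinctPairSum _ _ _),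
    mul_assoc (2 : ℝ)]
  rw [integral_sub ((h₁.mul h₁).add (h₂.mul h₂)).integrable ((h₁.mul h₂).integrable.const_mul 2),
    integral_add (h₁.mul h₁).integrable (h₂.mul h₂).integrable, integral_const_mul,
    integral_sub h₁.integrable h₂.integrable]
  simp only [integral_distinctPairSum_mul_distinctPairSum (h _ _) (h _ _) (h _ _) (h _ _),
    integral_distinctPairSum (h _ _) (h _ _), integral_multivariateGaussian_mul_four hSigma,
    integral_multivariateGaussian_mul hSigma]
  simp only [Matrix.det_fin_four, Matrix.det_fin_two, Matrix.submatrix_apply, Matrix.cons_val]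
  -- Symmetric entries are brought to one common form, after which the identity is purely
  -- polynomial.
  simp only [hs b a, hs c a, hs d a, hs c b, hs d b, hs d c]
  ring

end

/-! ### Transfer to the Wishart law -/

theorem corollary5p6 {Ω : Type*} [MeasurableSpace Ω] (P : Measure Ω) [IsProbabilityMeasure P]
    (r n : ℕ) (Sigma : Matrix (Fin r) (Fin r) ℝ) (hSigma : Sigma.PosDef)
    (S : Ω → Matrix (Fin r) (Fin r) ℝ) (hS : HasLaw S (wishart r n Sigma) P)
    (I J : Finset (Fin r)) (hI : I.card = 2) (hJ : J.card = 2) (hIJ : Disjoint I J) :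
    MemLp (fun ω => minor (S ω) I J hI hJ) 2 P ∧
      variance (fun ω => minor (S ω) I J hI hJ) P =
        (n : ℝ) * ((n : ℝ) - 1) *
          (((n : ℝ) + 2) * minor Sigma I I hI hI * minor Sigma J J hJ hJ
            - (n : ℝ) * minor Sigma (I ∪ J) (I ∪ J)
                (card_union_of_disjoint_of_card_eq hI hJ hIJ)
                (card_union_of_disjoint_of_card_eq hI hJ hIJ)
            + 3 * (n : ℝ) * (minor Sigma I J hI hJ) ^ 2) := by
  set a := I.orderEmbOfFin hI 0 with ha
  set b := I.orderEmbOfFin hI 1 with hb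
  set c := J.orderEmbOfFin hJ 0 with hc
  set d := J.orderEmbOfFin hJ 1 with hd
  have hIe : ⇑(I.orderEmbOfFin hI) = ![a, b] := by ext i; fin_cases i <;> rfl
  have hJe : ⇑(J.orderEmbOfFin hJ) = ![c, d] := by ext i; fin_cases i <;> rfl
  have haI : a ∈ I := I.orderEmbOfFin_mem hI 0
  have hbI : b ∈ I := I.orderEmbOfFin_mem hI 1
  have hcJ : c ∈ J := J.orderEmbOfFin_mem hJ 0
  have hdJ : d ∈ J := J.orderEmbOfFin_mem hJ 1
  have hab : a ≠ b := by simp [ha, hb]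
  have hcd : c ≠ d := by simp [hc, hd]
  have hne {i j : Fin r} (hi : i ∈ I) (hj : j ∈ J) : i ≠ j :=
    fun h => Finset.disjoint_left.1 hIJ hi (h ▸ hj)
  -- Listing I and then J need not be increasing on I ∪ J, but the principal minor does not depend
  -- on the order.
  have hunion := minor_self_eq_det_submatrix Sigma (I ∪ J)
    (card_union_of_disjoint_of_card_eq hI hJ hIJ) (s := ![a, b, c, d])
    (by
      intro i j
      fin_cases i <;> fin_cases j <;>
        simp [hab, hab.symm, hcd, hcd.symm, hne haI hcJ, hne haI hdJ, hne hbI hcJ, hne hbI hdJ,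
          (hne haI hcJ).symm, (hne haI hdJ).symm, (hne hbI hcJ).symm, (hne hbI hdJ).symm])
    (by intro i; fin_cases i <;> simp [haI, hbI, hcJ, hdJ])
  have hmeas : Measurable fun M : Matrix (Fin r) (Fin r) ℝ => minor M I J hI hJ := by
    have hentry (i j : Fin r) : Measurable fun M : Matrix (Fin r) (Fin r) ℝ => M i j :=
      (measurable_pi_apply j).comp (measurable_pi_apply i)
    simp only [minor, Matrix.det_fin_two, Matrix.submatrix_apply]
    exact ((hentry _ _).mul (hentry _ _)).sub ((hentry _ _).mul (hentry _ _))
  have hdata (x : Fin n → EuclideanSpace ℝ (Fin r)) :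
      minor (dataMatrix x * (dataMatrix x).transpose) I J hI hJ =
        (∑ k, x k a * x k c) * (∑ k, x k b * x k d)
          - (∑ k, x k a * x k d) * (∑ k, x k b * x k c) := by
    simp only [minor, Matrix.det_fin_two, Matrix.submatrix_apply, dataMatrix_mul_transpose_apply]
    rfl
  have hXX := measurable_dataMatrix_mul_transpose r n
  constructor
  · refine MemLp.comp_of_map (g := fun M => minor M I J hI hJ) ?_ hS.aemeasurable
    rw [hS.map_eq, wishart, memLp_map_measure_iff hmeas.aestronglyMeasurable hXX.aemeasurable]
    simpa only [Function.comp_def, hdata] using hasFiniteMoments_tetrad n a b c d 2 (by simp)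
  -- The variance of the minor under the Wishart measure is pulled back in two ways: along `S`, and
  -- along the map from the Gaussian columns to X Xᵀ.
  · have h₁ := variance_map (μ := P) (X := fun M => minor M I J hI hJ) (Y := S)
      hmeas.aemeasurable hS.aemeasurable
    have h₂ := variance_map (X := fun M => minor M I J hI hJ) (μ := Measure.pi fun _ : Fin n =>
      multivariateGaussian (0 : EuclideanSpace ℝ (Fin r)) Sigma) hmeas.aemeasurable hXX.aemeasurable
    rw [hS.map_eq] at h₁
    simp only [Function.comp_def, hdata] at h₁ h₂
    rw [← h₁, wishart, h₂, variance_tetrad hSigma.posSemidef, hunion, minor, minor, minor, hIe, hJe]
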